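/- Let $\Lambda^0(X)$ be the set of closed $\lambda$-terms, modulo $\alpha$-conversion, over a set $X$ of constants; let ${\bf I}=\lambda x.x$, ${\bf K}=\lambda x.\lambda y.x$ and ${\bf S}=\lambda x.\lambda y.\lambda z.(xz)(yz)$. Convergence $M\Downarrow V$ to principal weak head normal form is defined inductively as follows. * On $\Lambda^0=\Lambda^0(\varnothing)$ (the system $\ell$): $\lambda x.M\Downarrow\lambda x.M$; and if $M\Downarrow\lambda x.P$ and $P[N/x]\Downarrow Q$ then $MN\Downarrow Q$. * On $\Lambda^0(\{{\sf C}\})$ (the system $\ell_{\sf C}$): the same two rules, and ${\sf C}\Downarrow{\sf C}$; and if $M\Downarrow{\sf C}$ and $N\Downarrow$ then $MN\Downarrow{\bf I}$. * On $\Lambda^0(\{{\sf P}\})$ (the system $\ell_{\sf P}$): the same two rules as for $\ell$, and ${\sf P}\Downarrow{\sf P}$; if $L\Downarrow{\sf P}$ then $LM\Downarrow{\sf P}M$; and if $L\Downarrow{\sf P}M$ and ($M\Downarrow$ or $N\Downarrow$) then $LN\Downarrow{\bf I}$. Here $M\Downarrow$ means that $M\Downarrow V$ for some $V$. Each relation is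 a partial function, and gives a partial map $ev:A\rightharpoonup(A\to A)$ on the set $A$ of closed terms of the system: if $M\Downarrow\lambda x.N$ then $ev(M)$ is $P\mapsto N[P/x]$; if $M\Downarrow V$ with $V$ not an abstraction then $ev(M)$ is $P\mapsto VP$; and $ev(M)$ is undefined if $M$ does not converge. A relation $R\subseteq A\times A$ is an applicative bisimulation if $a\,R\,b$ and $ev(a)=f$ imply that $ev(b)$ is defined, $ev(b)=g$ say, and $f(c)\,R\,g(c)$ for all $c\in A$. Let $a\lesssim^B b$ mean that $a\,R\,b$ for some applicative bisimulation $R$ (equivalently, $a\lesssim_k b$ for all $k$, where $a\lesssim_0 b$ always, and $a\lesssim_{k+1}b$ iff $ev(a)=f$ implies that $ev(b)=g$ is defined and $f(c)\lesssim_k g(c)$ for all $c\in A$). Let $M\lesssim^C N$ mean that $C[M]\Downarrow$ implies $C[N]\Downarrow$ for every closed context $C[\cdot]$ of the system. Both relations are extended from $\Lambda^0$ to terms of $\ell$ with free variables by $M\lesssim N$ iff $M\sigma\lesssim N\sigma$ for all substitutions $\sigma$ of closed terms for variables. Put $a\cdot b=f(b)$ if $ev(a)=f$, and $a\cdot b=a$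 if $ev(a)$ is undefined. A term $M$ is interpreted in the system by an element $[\![M]\!]\in A$ by translating it into combinatory form, with $\lambda x.M$ translated as $\lambda^*x$ of the translation of $M$, where $\lambda^*x.x={\bf SKK}$, $\lambda^*x.M={\bf K}M$ if $x$ is not free in $M$, and $\lambda^*x.MN={\bf S}(\lambda^*x.M)(\lambda^*x.N)$ otherwise; application is then interpreted by $\cdot$, and ${\bf K}$, ${\bf S}$ and the constants by themselves, as elements of $A$. For closed $M,N$ write $\models M\sqsubseteq N$ for $[\![M]\!]\lesssim^B[\![N]\!]$, and $\models M\Downarrow$ for $[\![M]\!]\Downarrow$. **Theorem (Contextual Equivalence).** 1. In $\ell$, ${\lesssim^B}={\lesssim^C}$, on closed terms and on all terms. 2. For all $M,N\in\Lambda^0(\{{\sf C}\})$: $M\lesssim^B N\iff M\lesssim^C N$ in $\ell_{\sf C}$; and $\ell_{\sf C}\models M\sqsubseteq N$ if and only if, for all contexts $C[\cdot]\in\Lambda^0(\{{\sf C}\})$, $\ell_{\sf C}\models C[M]\Downarrow$ implies $\ell_{\sf C}\models C[N]\Downarrow$. 3. For all $M,N\in\Lambda^0(\{{\sf P}\})$: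 $M\lesssim^B N\iff M\lesssim^C N$ in $\ell_{\sf P}$; and $\ell_{\sf P}\models M\sqsubseteq N$ if and only if, for all contexts $C[\cdot]\in\Lambda^0(\{{\sf P}\})$, $\ell_{\sf P}\models C[M]\Downarrow$ implies $\ell_{\sf P}\models C[N]\Downarrow$. -/

import Mathlib

namespace LazyLambda

/-! ### Terms, substitution, contexts -/

/-- Lambda-terms over a set `κ` of constants, modulo alpha-conversion, with free variables among
`n` given ones (well-scoped de Bruijn terms). `Tm κ 0` is the set of closed terms. -/
inductive Tm (κ : Type) : ℕ → Type
  | var {n : ℕ} (i : Fin n) : Tm κ n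
  | con {n : ℕ} (c : κ) : Tm κ n
  | lam {n : ℕ} (M : Tm κ (n + 1)) : Tm κ n
  | app {n : ℕ} (M N : Tm κ n) : Tm κ n

namespace Tm

variable {κ : Type}

/-- Renaming of variables. -/
def rename : {n m : ℕ} → (Fin n → Fin m) → Tm κ n → Tm κ m
  | _, _, r, var i => var (r i)
  | _, _, _, con c => con c
  | _, _, r, lam M => lam (rename (Fin.cases 0 fun i => (r i).succ) M)
  | _, _, r, app M N => app (rename r M) (rename r N)

/-- Simultaneous capture-avoiding substitution. -/
def subst : {n m : ℕ} → (Fin n → Tm κ m) → Tm κ n → Tm κ m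
  | _, _, σ, var i => σ i
  | _, _, _, con c => con c
  | _, _, σ, lam M => lam (subst (Fin.cases (var 0) fun i => rename Fin.succ (σ i)) M)
  | _, _, σ, app M N => app (subst σ M) (subst σ N)

/-- `M.inst N` is `M[N/x]`, where `x` is the most recently bound variable. -/
def inst {n : ℕ} (M : Tm κ (n + 1)) (N : Tm κ n) : Tm κ n :=
  subst (Fin.cases N var) M

/-- `I = λx. x`. -/
def I {n : ℕ} : Tm κ n := lam (var 0)

/-- `λx. λy. x`. -/
def K {n : ℕ} : Tm κ n := lam (lam (var 1))

/-- `λx. λy. λz. (x z) (y z)`. -/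
def S {n : ℕ} : Tm κ n :=
  lam (lam (lam (app (app (var 2) (var 0)) (app (var 1) (var 0)))))

end Tm

/-- Contexts `C[·]` over `κ`, with any number of holes (possibly under binders), whose free
variables are among `n` given ones. `Ctx κ 0` is the set of closed contexts. -/
inductive Ctx (κ : Type) : ℕ → Type
  | hole {n : ℕ} : Ctx κ n
  | var {n : ℕ} (i : Fin n) : Ctx κ n
  | con {n : ℕ} (c : κ) : Ctx κ n
  | lam {n : ℕ} (C : Ctx κ (n + 1)) : Ctx κ n
  | app {n : ℕ} (C D : Ctx κ n) : Ctx κ n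

/-- `C[M]` for a closed term `M`: every hole is filled with `M`. -/
def Ctx.fill {κ : Type} : {n : ℕ} → Ctx κ n → Tm κ 0 → Tm κ n
  | _, .hole, M => M.rename Fin.elim0
  | _, .var i, _ => .var i
  | _, .con c, _ => .con c
  | _, .lam C, M => .lam (fill C M)
  | _, .app C D, M => .app (fill C M) (fill D M)

/-! ### Evaluation to weak head normal form -/

/-- Convergence to principal weak head normal form in the pure calculus. -/
inductive Eval : Tm Empty 0 → Tm Empty 0 → Prop
  | lam (M : Tm Empty 1) : Eval (.lam M) (.lam M)
  | beta {M N Q : Tm Empty 0} {P : Tm Empty 1} :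
      Eval M (.lam P) → Eval (P.inst N) Q → Eval (.app M N) Q

/-- The set of constants `{C}`. -/
inductive ConC : Type
  | C

/-- Convergence in the calculus with the convergence test `C`. An application whose operator
evaluates to `C` evaluates to `I` as soon as its argument converges. -/
inductive EvalC : Tm ConC 0 → Tm ConC 0 → Prop
  | lam (M : Tm ConC 1) : EvalC (.lam M) (.lam M)
  | beta {M N Q : Tm ConC 0} {P : Tm ConC 1} :
      EvalC M (.lam P) → EvalC (P.inst N) Q → EvalC (.app M N) Q
  | con : EvalC (.con .C) (.con .C)
  | test {M N V : Tm ConC 0} : EvalC M (.con .C) → EvalC N V → EvalC (.app M N) .I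

/-- The set of constants `{P}`. -/
inductive ConP : Type
  | P

/-- Convergence in the calculus with parallel convergence `P`. The weak head normal forms are
the abstractions, `P`, and the terms `P M`; an application whose operator evaluates to `P M`
evaluates to `I` as soon as `M` or its argument converges. -/
inductive EvalP : Tm ConP 0 → Tm ConP 0 → Prop
  | lam (M : Tm ConP 1) : EvalP (.lam M) (.lam M)
  | beta {M N Q : Tm ConP 0} {P : Tm ConP 1} :
      EvalP M (.lam P) → EvalP (P.inst N) Q → EvalP (.app M N) Q
  | con : EvalP (.con .P) (.con .P)
  | part {L M : Tm ConP 0} : EvalP L (.con .P) → EvalP (.app L M) (.app (.con .P) M)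
  | left {L M N V : Tm ConP 0} :
      EvalP L (.app (.con .P) M) → EvalP M V → EvalP (.app L N) .I
  | right {L M N V : Tm ConP 0} :
      EvalP L (.app (.con .P) M) → EvalP N V → EvalP (.app L N) .I

/-- Evaluation is deterministic. -/
theorem Eval.det {M V W : Tm Empty 0} (h : Eval M V) (h' : Eval M W) : V = W := by
  induction h generalizing W with
  | lam M => cases h'; rfl
  | beta h₁ h₂ ih₁ ih₂ =>
    cases h' with
    | beta k₁ k₂ =>
      have e := ih₁ k₁
      injection e with _ e
      subst e
      exact ih₂ k₂

/-- Evaluation with `C` is deterministic. -/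
theorem EvalC.det {M V W : Tm ConC 0} (h : EvalC M V) (h' : EvalC M W) : V = W := by
  induction h generalizing W with
  | lam M => cases h'; rfl
  | con => cases h'; rfl
  | beta h₁ h₂ ih₁ ih₂ =>
    cases h' with
    | beta k₁ k₂ =>
      have e := ih₁ k₁
      injection e with _ e
      subst e
      exact ih₂ k₂
    | test k₁ k₂ => cases ih₁ k₁
  | test h₁ h₂ ih₁ ih₂ =>
    cases h' with
    | beta k₁ k₂ => cases ih₁ k₁
    | test k₁ k₂ => rfl

/-- Evaluation with `P` is deterministic. -/
theorem EvalP.det {M V W : Tm ConP 0} (h : EvalP M V) (h' : EvalP M W) : V = W := by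
  induction h generalizing W with
  | lam M => cases h'; rfl
  | con => cases h'; rfl
  | beta h₁ h₂ ih₁ ih₂ =>
    cases h' with
    | beta k₁ k₂ =>
      have e := ih₁ k₁
      injection e with _ e
      subst e
      exact ih₂ k₂
    | part k₁ => cases ih₁ k₁
    | left k₁ k₂ => cases ih₁ k₁
    | right k₁ k₂ => cases ih₁ k₁
  | part h₁ ih₁ =>
    cases h' with
    | beta k₁ k₂ => cases ih₁ k₁
    | part k₁ => rfl
    | left k₁ k₂ => cases ih₁ k₁
    | right k₁ k₂ => cases ih₁ k₁
  | left h₁ h₂ ih₁ ih₂ =>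
    cases h' with
    | beta k₁ k₂ => cases ih₁ k₁
    | part k₁ => cases ih₁ k₁
    | left k₁ k₂ => rfl
    | right k₁ k₂ => rfl
  | right h₁ h₂ ih₁ ih₂ =>
    cases h' with
    | beta k₁ k₂ => cases ih₁ k₁
    | part k₁ => cases ih₁ k₁
    | left k₁ k₂ => rfl
    | right k₁ k₂ => rfl

/-! ### Applicative transition systems and applicative bisimulation -/

/-- A quasi-applicative transition system `(A, ev)`, `ev : A ⇀ (A → A)`, with two chosen elements
`k`, `s` that interpret the combinators. -/
structure TransSys (A : Type) where
  ev : A →. (A → A)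
  k : A
  s : A

namespace TransSys

variable {A : Type} (𝒜 : TransSys A)

/-- `a ⇓`. -/
def Conv (a : A) : Prop := (𝒜.ev a).Dom

/-- `R ⊆ F(R)`: `R` is an applicative bisimulation. -/
def IsBisim (R : A → A → Prop) : Prop :=
  ∀ a b, R a b → ∀ f ∈ 𝒜.ev a, ∃ g ∈ 𝒜.ev b, ∀ c, R (f c) (g c)

/-- The applicative bisimulation preorder `≲ᴮ`. -/
def SimB (a b : A) : Prop := ∃ R, 𝒜.IsBisim R ∧ R a b

/-- The finite approximations `≲ₖ`. -/
def SimK : ℕ → A → A → Prop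
  | 0, _, _ => True
  | k + 1, a, b => ∀ f ∈ 𝒜.ev a, ∃ g ∈ 𝒜.ev b, ∀ c, SimK k (f c) (g c)

/-- `≲ᴮ` is the intersection of its finite approximations. -/
theorem simB_iff_forall_simK {a b : A} : 𝒜.SimB a b ↔ ∀ k, 𝒜.SimK k a b := by
  constructor
  · rintro ⟨R, hR, hab⟩ k
    induction k generalizing a b with
    | zero => trivial
    | succ k ih =>
      intro f hf
      obtain ⟨g, hg, h⟩ := hR a b hab f hf
      exact ⟨g, hg, fun c => ih (h c)⟩
  · intro h
    refine ⟨fun a b => ∀ k, 𝒜.SimK k a b, ?_, h⟩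
    intro a b hab f hf
    obtain ⟨g, hg, -⟩ := hab 1 f hf
    refine ⟨g, hg, fun c k => ?_⟩
    obtain ⟨g', hg', h'⟩ := hab (k + 1) f hf
    rw [Part.mem_unique hg hg']
    exact h' c

open Classical in
/-- The derived application: `a · b = f b` if `a ⇓ f`, and `a · b = a` if `a` diverges. -/
noncomputable def ap (a b : A) : A :=
  if h : (𝒜.ev a).Dom then (𝒜.ev a).get h b else a

end TransSys

/-! ### Interpretation of lambda-terms through combinatory terms -/

/-- Combinatory terms over `A` (with a constant for each element of `A`) in `n` variables. -/
inductive CL (A : Type) : ℕ → Type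
  | var {n : ℕ} (i : Fin n) : CL A n
  | con {n : ℕ} (a : A) : CL A n
  | app {n : ℕ} (M N : CL A n) : CL A n

namespace CL

variable {A : Type}

/-- `M` as a term without the variable `0`, if that variable does not occur in it. -/
def strengthen {n : ℕ} : CL A (n + 1) → Option (CL A n)
  | var i => Fin.cases none (fun j => some (var j)) i
  | con a => some (con a)
  | app M N => (strengthen M).bind fun M' => (strengthen N).map fun N' => app M' N'

/-- The abstraction `λ*x. M` of variable `0`:
`λ*x. M = K M` if `x` does not occur in `M`, `λ*x. x = S K K`, and
`λ*x. M N = S (λ*x. M) (λ*x. N)` otherwise. -/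
def lamStar (𝒜 : TransSys A) {n : ℕ} : CL A (n + 1) → CL A n
  | var i => Fin.cases (app (app (con 𝒜.s) (con 𝒜.k)) (con 𝒜.k))
      (fun j => app (con 𝒜.k) (var j)) i
  | con a => app (con 𝒜.k) (con a)
  | app M N =>
    match strengthen (app M N) with
    | some L => app (con 𝒜.k) L
    | none => app (app (con 𝒜.s) (lamStar 𝒜 M)) (lamStar 𝒜 N)

/-- The value of a combinatory term under an environment. -/
noncomputable def interp (𝒜 : TransSys A) {n : ℕ} (ρ : Fin n → A) : CL A n → A
  | var i => ρ i
  | con a => a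
  | app M N => 𝒜.ap (interp 𝒜 ρ M) (interp 𝒜 ρ N)

end CL

/-- Translation of lambda-terms into combinatory terms, given an interpretation of constants. -/
def Tm.toCL {κ A : Type} (𝒜 : TransSys A) (e : κ → A) : {n : ℕ} → Tm κ n → CL A n
  | _, .var i => .var i
  | _, .con c => .con (e c)
  | _, .lam M => CL.lamStar 𝒜 (toCL 𝒜 e M)
  | _, .app M N => .app (toCL 𝒜 e M) (toCL 𝒜 e N)

/-- `𝒜 ⊨ M ⊑ N`. -/
def SatLE {κ A : Type} (𝒜 : TransSys A) (e : κ → A) {n : ℕ} (M N : Tm κ n) : Prop :=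
  ∀ ρ : Fin n → A, 𝒜.SimB ((M.toCL 𝒜 e).interp 𝒜 ρ) ((N.toCL 𝒜 e).interp 𝒜 ρ)

/-- `𝒜 ⊨ M ⇓`. -/
def SatConv {κ A : Type} (𝒜 : TransSys A) (e : κ → A) {n : ℕ} (M : Tm κ n) : Prop :=
  ∀ ρ : Fin n → A, 𝒜.Conv ((M.toCL 𝒜 e).interp 𝒜 ρ)

/-! ### The systems `ℓ`, `ℓ_C`, `ℓ_P` -/

/-- The action of a closed weak head normal form on an argument: an abstraction acts by
substitution, and any other one (`C`, `P` or `P M`) by application. -/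
def Tm.act {κ : Type} : Tm κ 0 → Tm κ 0 → Tm κ 0
  | .lam M, P => M.inst P
  | V, P => .app V P

/-- The transition system on closed terms given by a (deterministic) evaluation relation. -/
noncomputable def ofEval {κ : Type} (E : Tm κ 0 → Tm κ 0 → Prop) : TransSys (Tm κ 0) where
  ev M := ⟨∃ V, E M V, fun h => h.choose.act⟩
  k := .K
  s := .S

theorem mem_ofEval_ev {κ : Type} {E : Tm κ 0 → Tm κ 0 → Prop}
    (hE : ∀ {M V W}, E M V → E M W → V = W) {M : Tm κ 0} {f : Tm κ 0 → Tm κ 0} :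
    f ∈ (ofEval E).ev M ↔ ∃ V, E M V ∧ f = V.act := by
  constructor
  · rintro ⟨h, rfl⟩
    exact ⟨h.choose, h.choose_spec, rfl⟩
  · rintro ⟨V, h, rfl⟩
    have h' : ∃ V, E M V := ⟨V, h⟩
    exact ⟨h', congrArg Tm.act (hE h'.choose_spec h)⟩

/-- `ℓ`. -/
noncomputable def ell : TransSys (Tm Empty 0) := ofEval Eval

/-- `ℓ_C`. -/
noncomputable def ellC : TransSys (Tm ConC 0) := ofEval EvalC

/-- `ℓ_P`. -/
noncomputable def ellP : TransSys (Tm ConP 0) := ofEval EvalP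

/-! ### Contextual preorder -/

/-- The contextual preorder `≲ᶜ` on closed terms. -/
def CtxLE {κ : Type} (𝒜 : TransSys (Tm κ 0)) (M N : Tm κ 0) : Prop :=
  ∀ C : Ctx κ 0, 𝒜.Conv (C.fill M) → 𝒜.Conv (C.fill N)

/-- Extension of a relation on closed terms to open terms, through closed substitutions. -/
def OpenExt {κ : Type} (R : Tm κ 0 → Tm κ 0 → Prop) {n : ℕ} (M N : Tm κ n) : Prop :=
  ∀ σ : Fin n → Tm κ 0, R (M.subst σ) (N.subst σ)

end LazyLambda

/-!
All three calculi are instances of one pattern: evaluation is deterministic, abstractions are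
values, and an application `M N` has the same values as `U · N` whenever `M` evaluates to `U`
(`IsLazyEval`). Three arguments are carried out for an arbitrary relation of this kind.

* The contextual preorder is contained in the bisimulation preorder. Contexts `[·] c₁ … cₖ`
  suffice: the preorder `TestLE` that they induce is itself an applicative bisimulation.
* The bisimulation preorder is contained in the contextual preorder, by Howe's method. The relation
  `Howe` on open terms is compatible with all term formers and with substitution, contains the open
  extension of `≲ᴮ`, and absorbs it on the right. What remains is that it preserves convergence on
  closed terms (`HoweAdequate`); this follows, by induction on evaluation, from the statement that
  `Howe M N` and `M ⇓ V` imply `Howe V N`, and it is the only part in which the calculi differ.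
* The interpretation `⟦M⟧` is bisimilar to `M`. Indeed `a · b` is bisimilar to `a b`, and
  `λ*x. t` converges to an abstraction which acts like `t`, so that `λ*x. ⟦M⟧` and `λx. M` are
  bisimilar by extensionality. Compatibility of `≲ᴮ` with application, needed here, comes from
  Howe's method. The statements about satisfaction thus reduce to those about closed terms.
-/

namespace LazyLambda

/-! ### Substitution -/

namespace Tm

variable {κ : Type}

/-- The substitution `σ` carried under a binder. -/
def lift {n m : ℕ} (σ : Fin n → Tm κ m) : Fin (n + 1) → Tm κ (m + 1) :=
  Fin.cases (var 0) fun i => rename Fin.succ (σ i)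

@[simp] theorem lift_zero {n m : ℕ} (σ : Fin n → Tm κ m) : lift σ 0 = var 0 := rfl

@[simp] theorem lift_succ {n m : ℕ} (σ : Fin n → Tm κ m) (i : Fin n) :
    lift σ i.succ = rename Fin.succ (σ i) := rfl

theorem subst_lam {n m : ℕ} (σ : Fin n → Tm κ m) (M : Tm κ (n + 1)) :
    (lam M).subst σ = lam (M.subst (lift σ)) := rfl

theorem rename_eq_subst {n m : ℕ} (r : Fin n → Fin m) (M : Tm κ n) :
    M.rename r = M.subst fun i => var (r i) := by
  induction M generalizing m with
  | var i => rfl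
  | con c => rfl
  | app M N ihM ihN => simp only [rename, subst, ihM, ihN]
  | lam M ih =>
    simp only [rename, subst, ih]
    congr 2
    funext i
    cases i using Fin.cases <;> rfl

theorem subst_rename {n m k : ℕ} (r : Fin n → Fin m) (σ : Fin m → Tm κ k) (M : Tm κ n) :
    (M.rename r).subst σ = M.subst fun i => σ (r i) := by
  induction M generalizing m k with
  | var i => rfl
  | con c => rfl
  | app M N ihM ihN => simp only [rename, subst, ihM, ihN]
  | lam M ih =>
    simp only [rename, subst, ih]
    congr 2
    funext i
    cases i using Fin.cases <;> rfl

theorem rename_rename {n m k : ℕ} (r : Fin n → Fin m) (s : Fin m → Fin k) (M : Tm κ n) :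
    (M.rename r).rename s = M.rename fun i => s (r i) := by
  rw [rename_eq_subst s, subst_rename, rename_eq_subst]

theorem rename_subst {n m k : ℕ} (σ : Fin n → Tm κ m) (r : Fin m → Fin k) (M : Tm κ n) :
    (M.subst σ).rename r = M.subst fun i => (σ i).rename r := by
  induction M generalizing m k with
  | var i => rfl
  | con c => rfl
  | app M N ihM ihN => simp only [rename, subst, ihM, ihN]
  | lam M ih =>
    simp only [rename, subst, ih]
    congr 2
    funext i
    cases i using Fin.cases
    · rfl
    · simp [rename_rename]

theorem subst_subst {n m k : ℕ} (σ : Fin n → Tm κ m) (τ : Fin m → Tm κ k) (M : Tm κ n) :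
    (M.subst σ).subst τ = M.subst fun i => (σ i).subst τ := by
  induction M generalizing m k with
  | var i => rfl
  | con c => rfl
  | app M N ihM ihN => simp only [subst, ihM, ihN]
  | lam M ih =>
    simp only [subst, ih]
    congr 2
    funext i
    cases i using Fin.cases
    · rfl
    · simp [rename_subst, subst_rename]

@[simp] theorem subst_var {n : ℕ} (M : Tm κ n) : M.subst var = M := by
  induction M with
  | var i => rfl
  | con c => rfl
  | app M N ihM ihN => simp only [subst, ihM, ihN]
  | @lam n M ih =>
    have : lift (var : Fin n → Tm κ n) = var := by
      funext i
      cases i using Fin.cases <;> rfl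
    rw [subst_lam, this, ih]

/-- Closed terms are unaffected by substitution. -/
@[simp] theorem subst_closed (M : Tm κ 0) (σ : Fin 0 → Tm κ 0) : M.subst σ = M := by
  rw [Subsingleton.elim σ var, subst_var]

@[simp] theorem inst_rename_succ {n : ℕ} (M N : Tm κ n) : (M.rename Fin.succ).inst N = M := by
  rw [inst, subst_rename]
  exact subst_var M

/-- Substituting under a binder and then for the bound variable is one simultaneous
substitution. -/
theorem inst_subst_lift {n m : ℕ} (σ : Fin n → Tm κ m) (M : Tm κ (n + 1)) (N : Tm κ m) :
    (M.subst (lift σ)).inst N = M.subst (Fin.cases N σ) := by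
  rw [inst, subst_subst]
  congr 1
  funext i
  cases i using Fin.cases
  · rfl
  · exact inst_rename_succ _ _

end Tm

/-! ### Evaluation relations and their bisimulation preorder -/

variable {κ : Type} {E : Tm κ 0 → Tm κ 0 → Prop}

/-- The properties of evaluation common to the three calculi: it is a partial function, it fixes
abstractions, and applications are evaluated through the action of the value of the operator. -/
structure IsLazyEval (E : Tm κ 0 → Tm κ 0 → Prop) : Prop where
  det : ∀ {M V W}, E M V → E M W → V = W
  lam : ∀ M, E (.lam M) (.lam M)
  app_iff : ∀ {M N V}, E (.app M N) V ↔ ∃ U, E M U ∧ E (U.act N) V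

namespace IsLazyEval

theorem mem_ev (h : IsLazyEval E) {M : Tm κ 0} {f : Tm κ 0 → Tm κ 0} :
    f ∈ (ofEval E).ev M ↔ ∃ V, E M V ∧ f = V.act :=
  mem_ofEval_ev (E := E) (fun hV hW => h.det hV hW)

theorem isBisim_iff (h : IsLazyEval E) {R : Tm κ 0 → Tm κ 0 → Prop} :
    (ofEval E).IsBisim R ↔
      ∀ M N, R M N → ∀ V, E M V → ∃ W, E N W ∧ ∀ c, R (V.act c) (W.act c) := by
  constructor
  · intro H M N hR V hV
    obtain ⟨_, hg, H⟩ := H M N hR _ (h.mem_ev.2 ⟨V, hV, rfl⟩)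
    obtain ⟨W, hW, rfl⟩ := h.mem_ev.1 hg
    exact ⟨W, hW, H⟩
  · intro H M N hR _ hf
    obtain ⟨V, hV, rfl⟩ := h.mem_ev.1 hf
    obtain ⟨W, hW, H⟩ := H M N hR V hV
    exact ⟨_, h.mem_ev.2 ⟨W, hW, rfl⟩, H⟩

/-- `≲ᴮ` is itself an applicative bisimulation. -/
theorem simB_unfold (h : IsLazyEval E) {M N V : Tm κ 0} (hs : (ofEval E).SimB M N)
    (hV : E M V) : ∃ W, E N W ∧ ∀ c, (ofEval E).SimB (V.act c) (W.act c) := by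
  obtain ⟨R, hR, hMN⟩ := hs
  obtain ⟨W, hW, H⟩ := h.isBisim_iff.1 hR M N hMN V hV
  exact ⟨W, hW, fun c => ⟨R, hR, H c⟩⟩

theorem simB_conv (h : IsLazyEval E) {M N : Tm κ 0} (hs : (ofEval E).SimB M N)
    (hM : (ofEval E).Conv M) : (ofEval E).Conv N := by
  obtain ⟨V, hV⟩ := hM
  obtain ⟨W, hW, -⟩ := h.simB_unfold hs hV
  exact ⟨W, hW⟩

theorem simB_refl (h : IsLazyEval E) (M : Tm κ 0) : (ofEval E).SimB M M := by
  refine ⟨Eq, h.isBisim_iff.2 ?_, rfl⟩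
  rintro M _ rfl V hV
  exact ⟨V, hV, fun _ => rfl⟩

theorem simB_trans (h : IsLazyEval E) {L M N : Tm κ 0} (h₁ : (ofEval E).SimB L M)
    (h₂ : (ofEval E).SimB M N) : (ofEval E).SimB L N := by
  refine ⟨fun a c => ∃ b, (ofEval E).SimB a b ∧ (ofEval E).SimB b c,
    h.isBisim_iff.2 ?_, M, h₁, h₂⟩
  rintro a c ⟨b, hab, hbc⟩ V hV
  obtain ⟨W, hW, H⟩ := h.simB_unfold hab hV
  obtain ⟨X, hX, H'⟩ := h.simB_unfold hbc hW
  exact ⟨X, hX, fun d => ⟨_, H d, H' d⟩⟩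

/-- For `M ≲ᴮ N` it suffices to match one step of evaluation. -/
theorem simB_of_unfold (h : IsLazyEval E) {M N : Tm κ 0}
    (H : ∀ V, E M V → ∃ W, E N W ∧ ∀ c, (ofEval E).SimB (V.act c) (W.act c)) :
    (ofEval E).SimB M N := by
  refine ⟨fun a b => (a = M ∧ b = N) ∨ (ofEval E).SimB a b, h.isBisim_iff.2 ?_, .inl ⟨rfl, rfl⟩⟩
  rintro a b (⟨rfl, rfl⟩ | hab) V hV
  · obtain ⟨W, hW, H⟩ := H V hV
    exact ⟨W, hW, fun c => .inr (H c)⟩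
  · obtain ⟨W, hW, H⟩ := h.simB_unfold hab hV
    exact ⟨W, hW, fun c => .inr (H c)⟩

/-- A term is below every term that has the same value. -/
theorem simB_of_eval (h : IsLazyEval E) {M N : Tm κ 0} (H : ∀ V, E M V → E N V) :
    (ofEval E).SimB M N :=
  h.simB_of_unfold fun V hV => ⟨V, H V hV, fun _ => h.simB_refl _⟩

theorem app_simB_act (h : IsLazyEval E) {M V : Tm κ 0} (hV : E M V) (N : Tm κ 0) :
    (ofEval E).SimB (.app M N) (V.act N) := by
  refine h.simB_of_eval fun W hW => ?_
  obtain ⟨U, hU, hW⟩ := h.app_iff.1 hW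
  rwa [h.det hV hU]

theorem act_simB_app (h : IsLazyEval E) {M V : Tm κ 0} (hV : E M V) (N : Tm κ 0) :
    (ofEval E).SimB (V.act N) (.app M N) :=
  h.simB_of_eval fun _ hW => h.app_iff.2 ⟨V, hV, hW⟩

theorem simB_app_left (h : IsLazyEval E) {M N : Tm κ 0} (hs : (ofEval E).SimB M N)
    (c : Tm κ 0) : (ofEval E).SimB (.app M c) (.app N c) := by
  refine h.simB_of_unfold fun V hV => ?_
  obtain ⟨U, hU, hV⟩ := h.app_iff.1 hV
  obtain ⟨W, hW, H⟩ := h.simB_unfold hs hU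
  exact h.simB_unfold (h.simB_trans (H c) (h.act_simB_app hW c)) hV

end IsLazyEval

/-! ### Applicative tests -/

/-- The preorder of convergence under applications to closed terms. -/
def TestLE (E : Tm κ 0 → Tm κ 0 → Prop) (M N : Tm κ 0) : Prop :=
  ∀ cs : List (Tm κ 0), (ofEval E).Conv (cs.foldl .app M) → (ofEval E).Conv (cs.foldl .app N)

/-- A term as a context without holes. -/
def Tm.toCtx : {n : ℕ} → Tm κ n → Ctx κ n
  | _, .var i => .var i
  | _, .con c => .con c
  | _, .lam M => .lam M.toCtx
  | _, .app M N => .app M.toCtx N.toCtx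

theorem Tm.fill_toCtx {n : ℕ} (M : Tm κ n) (N : Tm κ 0) : M.toCtx.fill N = M := by
  induction M with
  | var i => rfl
  | con c => rfl
  | lam M ih => simp only [Tm.toCtx, Ctx.fill, ih]
  | app M N ihM ihN => simp only [Tm.toCtx, Ctx.fill, ihM, ihN]

theorem Ctx.fill_hole (M : Tm κ 0) : (Ctx.hole : Ctx κ 0).fill M = M := by
  rw [Ctx.fill, Tm.rename_eq_subst, Tm.subst_closed]

theorem CtxLE.testLE {M N : Tm κ 0} (h : CtxLE (ofEval E) M N) : TestLE E M N := by
  intro cs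
  have key : ∀ (C : Ctx κ 0) (P : Tm κ 0),
      (cs.foldl (fun D c => .app D c.toCtx) C).fill P = cs.foldl .app (C.fill P) := by
    induction cs with
    | nil => intro C P; rfl
    | cons c cs ih =>
      intro C P
      rw [List.foldl_cons, ih, Ctx.fill, Tm.fill_toCtx, List.foldl_cons]
  have := h (cs.foldl (fun D c => .app D c.toCtx) .hole)
  rwa [key, key, Ctx.fill_hole, Ctx.fill_hole] at this

namespace IsLazyEval

theorem simB_foldl_app (h : IsLazyEval E) {M N : Tm κ 0} (hs : (ofEval E).SimB M N)
    (cs : List (Tm κ 0)) : (ofEval E).SimB (cs.foldl .app M) (cs.foldl .app N) := by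
  induction cs generalizing M N with
  | nil => exact hs
  | cons c cs ih => exact ih (h.simB_app_left hs c)

/-- `TestLE` is an applicative bisimulation: by `β`-conversion, testing `V.act c` for the value `V`
of `M` amounts to testing `M` on one more argument. -/
theorem simB_of_testLE (h : IsLazyEval E) {M N : Tm κ 0} (ht : TestLE E M N) :
    (ofEval E).SimB M N := by
  refine ⟨TestLE E, h.isBisim_iff.2 ?_, ht⟩
  intro M N ht V hV
  obtain ⟨W, hW⟩ := ht [] ⟨V, hV⟩
  refine ⟨W, hW, fun c cs hc => ?_⟩
  have hM := h.simB_conv (h.simB_foldl_app (h.act_simB_app hV c) cs) hc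
  exact h.simB_conv (h.simB_foldl_app (h.app_simB_act hW c) cs) (ht (c :: cs) hM)

end IsLazyEval

/-! ### Howe's relation -/

/-- Howe's relation for the open extension of `≲ᴮ`: the terms below `N` are those obtained by
replacing the immediate subterms of some `N' ≲ᴮ N` by terms that are, recursively, below them. -/
inductive Howe (E : Tm κ 0 → Tm κ 0 → Prop) : {n : ℕ} → Tm κ n → Tm κ n → Prop
  | var {n : ℕ} {i : Fin n} {N : Tm κ n} :
      OpenExt (ofEval E).SimB (.var i) N → Howe E (.var i) N
  | con {n : ℕ} {c : κ} {N : Tm κ n} :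
      OpenExt (ofEval E).SimB (.con c) N → Howe E (.con c) N
  | lam {n : ℕ} {M M' : Tm κ (n + 1)} {N : Tm κ n} :
      Howe E M M' → OpenExt (ofEval E).SimB (.lam M') N → Howe E (.lam M) N
  | app {n : ℕ} {L L' M M' N : Tm κ n} :
      Howe E L L' → Howe E M M' → OpenExt (ofEval E).SimB (.app L' M') N →
      Howe E (.app L M) N

theorem openExt_closed {R : Tm κ 0 → Tm κ 0 → Prop} {M N : Tm κ 0} :
    OpenExt R M N ↔ R M N := by
  simp [OpenExt]

theorem OpenExt.subst {R : Tm κ 0 → Tm κ 0 → Prop} {n m : ℕ} {M N : Tm κ n}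
    (h : OpenExt R M N) (σ : Fin n → Tm κ m) : OpenExt R (M.subst σ) (N.subst σ) := by
  intro τ
  rw [Tm.subst_subst, Tm.subst_subst]
  exact h _

theorem OpenExt.rename {R : Tm κ 0 → Tm κ 0 → Prop} {n m : ℕ} {M N : Tm κ n}
    (h : OpenExt R M N) (r : Fin n → Fin m) : OpenExt R (M.rename r) (N.rename r) := by
  rw [Tm.rename_eq_subst, Tm.rename_eq_subst]
  exact h.subst _

namespace IsLazyEval

theorem openExt_refl (h : IsLazyEval E) {n : ℕ} (M : Tm κ n) :
    OpenExt (ofEval E).SimB M M := fun _ => h.simB_refl _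

theorem howe_trans (h : IsLazyEval E) {n : ℕ} {L M N : Tm κ n} (h₁ : Howe E L M)
    (h₂ : OpenExt (ofEval E).SimB M N) : Howe E L N := by
  cases h₁ with
  | var k => exact .var fun σ => h.simB_trans (k σ) (h₂ σ)
  | con k => exact .con fun σ => h.simB_trans (k σ) (h₂ σ)
  | lam a k => exact .lam a fun σ => h.simB_trans (k σ) (h₂ σ)
  | app a b k => exact .app a b fun σ => h.simB_trans (k σ) (h₂ σ)

theorem howe_refl (h : IsLazyEval E) {n : ℕ} (M : Tm κ n) : Howe E M M := by
  induction M with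
  | var i => exact .var (h.openExt_refl _)
  | con c => exact .con (h.openExt_refl _)
  | lam M ih => exact .lam ih (h.openExt_refl _)
  | app M N ihM ihN => exact .app ihM ihN (h.openExt_refl _)

theorem howe_of_openExt (h : IsLazyEval E) {n : ℕ} {M N : Tm κ n}
    (hs : OpenExt (ofEval E).SimB M N) : Howe E M N :=
  h.howe_trans (h.howe_refl M) hs

end IsLazyEval

theorem Howe.rename {n m : ℕ} {M N : Tm κ n} (hH : Howe E M N) (r : Fin n → Fin m) :
    Howe E (M.rename r) (N.rename r) := by
  induction hH generalizing m with
  | var k => exact .var (k.rename r)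
  | con k => exact .con (k.rename r)
  | lam _ k ih => exact .lam (ih _) (k.rename r)
  | app _ _ k ih₁ ih₂ => exact .app (ih₁ _) (ih₂ _) (k.rename r)

namespace IsLazyEval

/-- Howe's relation is closed under substitution of related terms, unlike, a priori, the open
extension of `≲ᴮ`. -/
theorem howe_subst (h : IsLazyEval E) {n m : ℕ} {M N : Tm κ n} (hH : Howe E M N)
    {σ τ : Fin n → Tm κ m} (hσ : ∀ i, Howe E (σ i) (τ i)) :
    Howe E (M.subst σ) (N.subst τ) := by
  induction hH generalizing m with
  | @var _ i _ k => exact h.howe_trans (hσ i) (k.subst τ)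
  | con k => exact .con (k.subst τ)
  | lam _ k ih =>
    refine .lam (ih fun i => ?_) (k.subst τ)
    cases i using Fin.cases with
    | zero => exact h.howe_refl _
    | succ i => exact (hσ i).rename _
  | app _ _ k ih₁ ih₂ => exact .app (ih₁ hσ) (ih₂ hσ) (k.subst τ)

theorem howe_inst (h : IsLazyEval E) {P P' : Tm κ 1} {A A' : Tm κ 0} (hP : Howe E P P')
    (hA : Howe E A A') : Howe E (P.inst A) (P'.inst A') :=
  h.howe_subst hP (Fin.cases hA fun _ => h.howe_refl _)

theorem howe_fill (h : IsLazyEval E) {M N : Tm κ 0} (hH : Howe E M N) {n : ℕ}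
    (C : Ctx κ n) : Howe E (C.fill M) (C.fill N) := by
  induction C with
  | hole => exact hH.rename _
  | var i => exact h.howe_refl _
  | con c => exact h.howe_refl _
  | lam C ih => exact .lam ih (h.openExt_refl _)
  | app C D ihC ihD => exact .app ihC ihD (h.openExt_refl _)

end IsLazyEval

/-- Howe's relation preserves convergence of closed terms. -/
def HoweAdequate (E : Tm κ 0 → Tm κ 0 → Prop) : Prop :=
  ∀ {M N : Tm κ 0}, Howe E M N → (ofEval E).Conv M → (ofEval E).Conv N

namespace IsLazyEval

/-- An adequate Howe relation is contained in `≲ᴮ`, because it is compatible with the applicative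
tests. -/
theorem simB_of_howe (h : IsLazyEval E) (ha : HoweAdequate E) {M N : Tm κ 0}
    (hH : Howe E M N) : (ofEval E).SimB M N := by
  refine h.simB_of_testLE fun cs => ha ?_
  induction cs generalizing M N with
  | nil => exact hH
  | cons c cs ih => exact ih (.app hH (h.howe_refl c) (h.openExt_refl _))

/-- `≲ᴮ` is compatible with application. -/
theorem simB_app (h : IsLazyEval E) (ha : HoweAdequate E) {L L' M M' : Tm κ 0}
    (hL : (ofEval E).SimB L L') (hM : (ofEval E).SimB M M') :
    (ofEval E).SimB (.app L M) (.app L' M') :=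
  h.simB_of_howe ha (.app (h.howe_of_openExt (openExt_closed.2 hL))
    (h.howe_of_openExt (openExt_closed.2 hM)) (h.openExt_refl _))

/-- The bisimulation preorder is the contextual preorder. -/
theorem simB_iff_ctxLE (h : IsLazyEval E) (ha : HoweAdequate E) {M N : Tm κ 0} :
    (ofEval E).SimB M N ↔ CtxLE (ofEval E) M N :=
  ⟨fun hs C => ha (h.howe_fill (h.howe_of_openExt (openExt_closed.2 hs)) C),
    fun hc => h.simB_of_testLE hc.testLE⟩

/-- The `β` case of the induction on evaluation: if the value `λx. P` of `M` is below everything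
that `M` is below, then `P[N/x]` is below everything that `M N` is below. -/
theorem howe_beta (h : IsLazyEval E) {M N L : Tm κ 0} {P : Tm κ 1}
    (ih : ∀ L, Howe E M L → Howe E (.lam P) L) (hH : Howe E (.app M N) L) :
    Howe E (P.inst N) L := by
  cases hH with
  | app hM hN hs =>
    cases ih _ hM with
    | @lam _ _ P' _ hP hl =>
      rw [openExt_closed] at hs hl
      -- `P[N/x]` is below `P'[N'/x]`, and `P'[N'/x] ≲ᴮ (λx. P') N' ≲ᴮ L`
      refine h.howe_trans (h.howe_inst hP hN) (openExt_closed.2 ?_)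
      exact h.simB_trans (h.act_simB_app (h.lam P') _)
        (h.simB_trans (h.simB_app_left hl _) hs)

theorem conv_of_howe_lam (h : IsLazyEval E) {P : Tm κ 1} {N : Tm κ 0}
    (hH : Howe E (.lam P) N) : (ofEval E).Conv N := by
  cases hH with
  | lam _ hl => exact h.simB_conv (openExt_closed.1 hl) ⟨_, h.lam _⟩

end IsLazyEval

theorem simB_of_howe_con {c : κ} {N : Tm κ 0} (hH : Howe E (.con c) N) :
    (ofEval E).SimB (.con c) N := by
  cases hH with
  | con hc => exact openExt_closed.1 hc

/-! ### The pure calculus -/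

theorem Eval.exists_lam {M V : Tm Empty 0} (h : Eval M V) : ∃ P, V = .lam P := by
  induction h with
  | lam P => exact ⟨P, rfl⟩
  | beta _ _ _ ih => exact ih

theorem Eval.isLazyEval : IsLazyEval Eval where
  det := Eval.det
  lam := Eval.lam
  app_iff := by
    intro M N V
    constructor
    · rintro (_ | ⟨h₁, h₂⟩)
      exact ⟨_, h₁, h₂⟩
    · rintro ⟨U, h₁, h₂⟩
      obtain ⟨P, rfl⟩ := h₁.exists_lam
      exact .beta h₁ h₂

/-- The value of a term stays below everything that the term is below in Howe's relation. -/
theorem Eval.howe {M V N : Tm Empty 0} (hV : Eval M V) (hH : Howe Eval M N) :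
    Howe Eval V N := by
  induction hV generalizing N with
  | lam M => exact hH
  | beta _ _ ih₁ ih₂ => exact ih₂ (Eval.isLazyEval.howe_beta (fun _ => ih₁) hH)

theorem Eval.howeAdequate : HoweAdequate Eval := by
  rintro M N hH ⟨V, hV⟩
  obtain ⟨P, rfl⟩ := hV.exists_lam
  exact Eval.isLazyEval.conv_of_howe_lam (hV.howe hH)

/-! ### The calculus with convergence testing -/

theorem EvalC.value {M V : Tm ConC 0} (h : EvalC M V) : (∃ P, V = .lam P) ∨ V = .con .C := by
  induction h with
  | lam P => exact .inl ⟨P, rfl⟩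
  | beta _ _ _ ih => exact ih
  | con => exact .inr rfl
  | test => exact .inl ⟨_, rfl⟩

theorem EvalC.isLazyEval : IsLazyEval EvalC where
  det := EvalC.det
  lam := EvalC.lam
  app_iff := by
    intro M N V
    constructor
    · rintro (_ | ⟨h₁, h₂⟩ | _ | ⟨h₁, h₂⟩)
      · exact ⟨_, h₁, h₂⟩
      · exact ⟨_, h₁, .test .con h₂⟩
    · rintro ⟨U, h₁, h₂⟩
      obtain ⟨P, rfl⟩ | rfl := h₁.value
      · exact .beta h₁ h₂
      · cases h₂ with
        | beta k => cases k
        | test _ k => exact .test h₁ k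

theorem EvalC.conv_of_howe {M V N : Tm ConC 0} (hV : EvalC M V) (hH : Howe EvalC V N) :
    ellC.Conv N := by
  obtain ⟨P, rfl⟩ | rfl := hV.value
  · exact EvalC.isLazyEval.conv_of_howe_lam hH
  · exact EvalC.isLazyEval.simB_conv (simB_of_howe_con hH) ⟨_, .con⟩

/-- The value of a term stays below everything that the term is below in Howe's relation. -/
theorem EvalC.howe {M V N : Tm ConC 0} (hV : EvalC M V) (hH : Howe EvalC M N) :
    Howe EvalC V N := by
  have H := EvalC.isLazyEval
  induction hV generalizing N with
  | lam M => exact hH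
  | beta _ _ ih₁ ih₂ => exact ih₂ (H.howe_beta (fun _ => ih₁) hH)
  | con => exact hH
  | test _ h₂ ih₁ ih₂ =>
    cases hH with
    | @app _ _ L' _ M' _ hL hM hs =>
      obtain ⟨W, hW⟩ := h₂.conv_of_howe (ih₂ hM)
      refine H.howe_of_openExt (openExt_closed.2 ?_)
      -- `I ≲ᴮ C M' ≲ᴮ L' M' ≲ᴮ N`
      refine H.simB_trans (H.simB_of_eval (N := .app (.con .C) M') ?_) (H.simB_trans
        (H.simB_app_left (simB_of_howe_con (ih₁ hL)) M') (openExt_closed.1 hs))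
      intro V hV
      cases hV
      exact .test .con hW

theorem EvalC.howeAdequate : HoweAdequate EvalC :=
  fun hH ⟨_, hV⟩ => hV.conv_of_howe (hV.howe hH)

/-! ### The calculus with parallel convergence -/

theorem EvalP.value {M V : Tm ConP 0} (h : EvalP M V) :
    (∃ P, V = .lam P) ∨ V = .con .P ∨ ∃ L, V = .app (.con .P) L := by
  induction h with
  | lam P => exact .inl ⟨P, rfl⟩
  | beta _ _ _ ih => exact ih
  | con => exact .inr (.inl rfl)
  | part => exact .inr (.inr ⟨_, rfl⟩)
  | left => exact .inl ⟨_, rfl⟩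
  | right => exact .inl ⟨_, rfl⟩

theorem EvalP.isLazyEval : IsLazyEval EvalP where
  det := EvalP.det
  lam := EvalP.lam
  app_iff := by
    intro M N V
    constructor
    · intro h
      cases h with
      | beta h₁ h₂ => exact ⟨_, h₁, h₂⟩
      | part h₁ => exact ⟨_, h₁, .part .con⟩
      | left h₁ h₂ => exact ⟨_, h₁, .left (.part .con) h₂⟩
      | right h₁ h₂ => exact ⟨_, h₁, .right (.part .con) h₂⟩
    · rintro ⟨U, h₁, h₂⟩
      obtain ⟨P, rfl⟩ | rfl | ⟨L, rfl⟩ := h₁.value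
      · exact .beta h₁ h₂
      · rw [h₂.det (.part .con)]
        exact .part h₁
      · cases h₂ with
        | beta k => cases k.det (.part .con)
        | part k => cases k.det (.part .con)
        | left k k' => cases k.det (.part .con); exact .left h₁ k'
        | right k k' => cases k.det (.part .con); exact .right h₁ k'

/-- Inverting Howe's relation at `P M` yields a term `L' M'` with `P ≲ᴮ L'`; this `L'` can be taken
to be `P`, since `≲ᴮ` is compatible with application on the left. -/
theorem EvalP.howe_partial_inv {M N : Tm ConP 0} (hH : Howe EvalP (.app (.con .P) M) N) :
    ∃ M', Howe EvalP M M' ∧ ellP.SimB (.app (.con .P) M') N := by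
  cases hH with
  | app hP hM hs =>
    exact ⟨_, hM, EvalP.isLazyEval.simB_trans
      (EvalP.isLazyEval.simB_app_left (simB_of_howe_con hP) _) (openExt_closed.1 hs)⟩

theorem EvalP.conv_of_howe {M V N : Tm ConP 0} (hV : EvalP M V) (hH : Howe EvalP V N) :
    ellP.Conv N := by
  obtain ⟨P, rfl⟩ | rfl | ⟨L, rfl⟩ := hV.value
  · exact EvalP.isLazyEval.conv_of_howe_lam hH
  · exact EvalP.isLazyEval.simB_conv (simB_of_howe_con hH) ⟨_, .con⟩
  · obtain ⟨M', -, hs⟩ := EvalP.howe_partial_inv hH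
    exact EvalP.isLazyEval.simB_conv hs ⟨_, .part .con⟩

/-- The value of a term stays below everything that the term is below in Howe's relation. -/
theorem EvalP.howe {M V N : Tm ConP 0} (hV : EvalP M V) (hH : Howe EvalP M N) :
    Howe EvalP V N := by
  have H := EvalP.isLazyEval
  -- `I ≲ᴮ P M' A ≲ᴮ L A ≲ᴮ N` when `M'` or `A` converges
  have key : ∀ {M' L A N : Tm ConP 0}, ellP.SimB (.app (.con .P) M') L →
      OpenExt ellP.SimB (.app L A) N → EvalP (.app (.app (.con .P) M') A) .I →
      Howe EvalP .I N := by
    intro M' L A N hL hs hI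
    refine H.howe_of_openExt (openExt_closed.2 (H.simB_trans (H.simB_of_eval fun V hV => ?_)
      (H.simB_trans (H.simB_app_left hL A) (openExt_closed.1 hs))))
    cases hV
    exact hI
  induction hV generalizing N with
  | lam M => exact hH
  | beta _ _ ih₁ ih₂ => exact ih₂ (H.howe_beta (fun _ => ih₁) hH)
  | con => exact hH
  | part _ ih =>
    cases hH with
    | app hL hM hs =>
      exact .app (H.howe_refl _) hM (openExt_closed.2 (H.simB_trans
        (H.simB_app_left (simB_of_howe_con (ih hL)) _) (openExt_closed.1 hs)))
  | left _ h₂ ih₁ ih₂ =>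
    cases hH with
    | app hL hA hs =>
      obtain ⟨M', hM, hs'⟩ := EvalP.howe_partial_inv (ih₁ hL)
      obtain ⟨W, hW⟩ := h₂.conv_of_howe (ih₂ hM)
      exact key hs' hs (.left (.part .con) hW)
  | right _ h₂ ih₁ ih₂ =>
    cases hH with
    | app hL hA hs =>
      obtain ⟨M', -, hs'⟩ := EvalP.howe_partial_inv (ih₁ hL)
      obtain ⟨W, hW⟩ := h₂.conv_of_howe (ih₂ hA)
      exact key hs' hs (.right (.part .con) hW)

theorem EvalP.howeAdequate : HoweAdequate EvalP :=
  fun hH ⟨_, hV⟩ => hV.conv_of_howe (hV.howe hH)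

/-! ### The interpretation through combinatory terms -/

theorem CL.interp_strengthen {A : Type} (𝒜 : TransSys A) {n : ℕ} (ρ : Fin n → A) (c : A)
    (t : CL A (n + 1)) {L : CL A n} (hL : t.strengthen = some L) :
    t.interp 𝒜 (Fin.cases c ρ) = L.interp 𝒜 ρ := by
  match t with
  | .var i =>
    cases i using Fin.cases with
    | zero => cases hL
    | succ j => cases hL; rfl
  | .con a => cases hL; rfl
  | .app M N =>
    simp only [CL.strengthen, Option.bind_eq_some_iff, Option.map_eq_some_iff] at hL
    obtain ⟨M', hM, N', hN, rfl⟩ := hL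
    rw [CL.interp, CL.interp, interp_strengthen 𝒜 ρ c M hM, interp_strengthen 𝒜 ρ c N hN]

/-- Bisimilarity: `≲ᴮ` in both directions. -/
def EqB (E : Tm κ 0 → Tm κ 0 → Prop) (M N : Tm κ 0) : Prop :=
  (ofEval E).SimB M N ∧ (ofEval E).SimB N M

theorem EqB.symm {M N : Tm κ 0} (h : EqB E M N) : EqB E N M := ⟨h.2, h.1⟩

namespace IsLazyEval

theorem eqB_refl (h : IsLazyEval E) (M : Tm κ 0) : EqB E M M :=
  ⟨h.simB_refl M, h.simB_refl M⟩

theorem eqB_trans (h : IsLazyEval E) {L M N : Tm κ 0} (h₁ : EqB E L M) (h₂ : EqB E M N) :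
    EqB E L N :=
  ⟨h.simB_trans h₁.1 h₂.1, h.simB_trans h₂.2 h₁.2⟩

theorem eqB_app (h : IsLazyEval E) (ha : HoweAdequate E) {L L' M M' : Tm κ 0}
    (hL : EqB E L L') (hM : EqB E M M') : EqB E (.app L M) (.app L' M') :=
  ⟨h.simB_app ha hL.1 hM.1, h.simB_app ha hL.2 hM.2⟩

theorem eqB_app_act (h : IsLazyEval E) {M V : Tm κ 0} (hV : E M V) (N : Tm κ 0) :
    EqB E (.app M N) (V.act N) :=
  ⟨h.app_simB_act hV N, h.act_simB_app hV N⟩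

theorem ap_eq_act (h : IsLazyEval E) {M V : Tm κ 0} (hV : E M V) (N : Tm κ 0) :
    (ofEval E).ap M N = V.act N := by
  have hM : ((ofEval E).ev M).Dom := ⟨V, hV⟩
  have hf : ((ofEval E).ev M).get hM = V.act :=
    Part.get_eq_of_mem (h.mem_ev.2 ⟨V, hV, rfl⟩) hM
  rw [TransSys.ap, dif_pos hM, hf]

theorem ap_eqB_app (h : IsLazyEval E) (M N : Tm κ 0) :
    EqB E ((ofEval E).ap M N) (.app M N) := by
  by_cases hM : ∃ V, E M V
  · obtain ⟨V, hV⟩ := hM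
    rw [h.ap_eq_act hV]
    exact ⟨h.act_simB_app hV N, h.app_simB_act hV N⟩
  · have : (ofEval E).ap M N = M := dif_neg hM
    rw [this]
    constructor <;> refine h.simB_of_eval fun V hV => (hM ?_).elim
    · exact ⟨V, hV⟩
    · obtain ⟨U, hU, -⟩ := h.app_iff.1 hV
      exact ⟨U, hU⟩

theorem ap_K (h : IsLazyEval E) (M : Tm κ 0) :
    (ofEval E).ap .K M = .lam (M.rename Fin.succ) :=
  h.ap_eq_act (h.lam _) M

theorem ap_ap_S (h : IsLazyEval E) (L M : Tm κ 0) :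
    (ofEval E).ap ((ofEval E).ap .S L) M =
      .lam (.app (.app (L.rename Fin.succ) (.var 0)) (.app (M.rename Fin.succ) (.var 0))) := by
  have e : (ofEval E).ap .S L = .lam (.lam (.app
      (.app ((L.rename Fin.succ).rename Fin.succ) (.var 0)) (.app (.var 1) (.var 0)))) :=
    h.ap_eq_act (h.lam _) L
  rw [e, h.ap_eq_act (h.lam _)]
  simp only [Tm.act, Tm.inst, Tm.subst, Tm.subst_rename]
  rw [Tm.rename_eq_subst Fin.succ L]
  rfl

/-- `λ*x. t` is an abstraction that acts like `t`. -/
theorem interp_lamStar (h : IsLazyEval E) (ha : HoweAdequate E) {n : ℕ}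
    (t : CL (Tm κ 0) (n + 1)) (ρ : Fin n → Tm κ 0) :
    ∃ P, (t.lamStar (ofEval E)).interp (ofEval E) ρ = .lam P ∧
      ∀ c, EqB E (P.inst c) (t.interp (ofEval E) (Fin.cases c ρ)) := by
  match t with
  | .var i =>
    cases i using Fin.cases with
    | zero =>
      -- the abstraction is `λz. K z (K z)`, which acts as the identity
      refine ⟨_, h.ap_ap_S .K .K, fun c => ?_⟩
      have hK : E (.app .K c) (.lam (c.rename Fin.succ)) :=
        h.app_iff.2 ⟨_, h.lam _, h.lam _⟩
      have := h.eqB_app_act hK (.app .K c)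
      rwa [Tm.act, Tm.inst_rename_succ] at this
    | succ j =>
      refine ⟨_, h.ap_K (ρ j), fun c => ?_⟩
      rw [Tm.inst_rename_succ]
      exact h.eqB_refl _
  | .con a =>
    refine ⟨_, h.ap_K a, fun c => ?_⟩
    rw [Tm.inst_rename_succ]
    exact h.eqB_refl _
  | .app M N =>
    rw [CL.lamStar]
    cases hL : (CL.app M N).strengthen with
    | some L =>
      refine ⟨_, h.ap_K (L.interp (ofEval E) ρ), fun c => ?_⟩
      rw [Tm.inst_rename_succ, CL.interp_strengthen _ ρ c _ hL]
      exact h.eqB_refl _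
    | none =>
      obtain ⟨P, hP, HP⟩ := interp_lamStar h ha M ρ
      obtain ⟨Q, hQ, HQ⟩ := interp_lamStar h ha N ρ
      refine ⟨_, h.ap_ap_S _ _, fun c => ?_⟩
      rw [hP, hQ]
      have hM := h.eqB_trans (h.eqB_app_act (h.lam P) c) (HP c)
      have hN := h.eqB_trans (h.eqB_app_act (h.lam Q) c) (HQ c)
      have key := h.eqB_trans (h.eqB_app ha hM hN) ((h.ap_eqB_app _ _).symm)
      rwa [← Tm.inst_rename_succ (.lam P) c, ← Tm.inst_rename_succ (.lam Q) c] at key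

/-- The interpretation of a term is bisimilar to the term. -/
theorem interp_toCL (h : IsLazyEval E) (ha : HoweAdequate E) {n : ℕ} (M : Tm κ n)
    (ρ : Fin n → Tm κ 0) :
    EqB E ((M.toCL (ofEval E) .con).interp (ofEval E) ρ) (M.subst ρ) := by
  induction M with
  | var i => exact h.eqB_refl _
  | con c => exact h.eqB_refl _
  | app M N ihM ihN =>
    exact h.eqB_trans (h.ap_eqB_app _ _) (h.eqB_app ha (ihM ρ) (ihN ρ))
  | lam M ih =>
    obtain ⟨P, hP, H⟩ := h.interp_lamStar ha (M.toCL (ofEval E) .con) ρ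
    have hc : ∀ c, EqB E (P.inst c) ((M.subst (Tm.lift ρ)).inst c) := fun c => by
      rw [Tm.inst_subst_lift]
      exact h.eqB_trans (H c) (ih _)
    rw [Tm.toCL, hP, Tm.subst_lam]
    constructor <;> refine h.simB_of_unfold fun V hV => ?_ <;>
      cases h.det hV (h.lam _) <;> refine ⟨_, h.lam _, fun c => ?_⟩
    · exact (hc c).1
    · exact (hc c).2

theorem satLE_iff (h : IsLazyEval E) (ha : HoweAdequate E) (M N : Tm κ 0) :
    SatLE (ofEval E) Tm.con M N ↔ (ofEval E).SimB M N := by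
  have H : ∀ (M : Tm κ 0) (ρ : Fin 0 → Tm κ 0),
      EqB E ((M.toCL (ofEval E) .con).interp (ofEval E) ρ) M := fun M ρ => by
    simpa using h.interp_toCL ha M ρ
  constructor
  · intro hs
    exact h.simB_trans (H M Fin.elim0).2 (h.simB_trans (hs Fin.elim0) (H N Fin.elim0).1)
  · intro hs ρ
    exact h.simB_trans (H M ρ).1 (h.simB_trans hs (H N ρ).2)

theorem satConv_iff (h : IsLazyEval E) (ha : HoweAdequate E) (M : Tm κ 0) :
    SatConv (ofEval E) Tm.con M ↔ (ofEval E).Conv M := by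
  have H : ∀ ρ : Fin 0 → Tm κ 0,
      EqB E ((M.toCL (ofEval E) .con).interp (ofEval E) ρ) M := fun ρ => by
    simpa using h.interp_toCL ha M ρ
  exact ⟨fun hc => h.simB_conv (H Fin.elim0).1 (hc Fin.elim0),
    fun hc ρ => h.simB_conv (H ρ).2 hc⟩

theorem satLE_iff_satConv (h : IsLazyEval E) (ha : HoweAdequate E) (M N : Tm κ 0) :
    SatLE (ofEval E) Tm.con M N ↔ ∀ C : Ctx κ 0,
      SatConv (ofEval E) Tm.con (C.fill M) → SatConv (ofEval E) Tm.con (C.fill N) := by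
  simp only [h.satLE_iff ha, h.satConv_iff ha]
  exact h.simB_iff_ctxLE ha

end IsLazyEval

end LazyLambda

open LazyLambda in
theorem mainTheorem11 :
    -- the pure calculus: closed terms, and all terms
    (∀ M N : Tm Empty 0, ell.SimB M N ↔ CtxLE ell M N) ∧
    (∀ (n : ℕ) (M N : Tm Empty n), OpenExt ell.SimB M N ↔ OpenExt (CtxLE ell) M N) ∧
    -- the calculus with convergence testing
    (∀ M N : Tm ConC 0, ellC.SimB M N ↔ CtxLE ellC M N) ∧
    (∀ M N : Tm ConC 0, SatLE ellC Tm.con M N ↔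
      ∀ C : Ctx ConC 0, SatConv ellC Tm.con (C.fill M) → SatConv ellC Tm.con (C.fill N)) ∧
    -- the calculus with parallel convergence
    (∀ M N : Tm ConP 0, ellP.SimB M N ↔ CtxLE ellP M N) ∧
    (∀ M N : Tm ConP 0, SatLE ellP Tm.con M N ↔
      ∀ C : Ctx ConP 0, SatConv ellP Tm.con (C.fill M) → SatConv ellP Tm.con (C.fill N)) := by
  have hE (M N : Tm Empty 0) : ell.SimB M N ↔ CtxLE ell M N :=
    Eval.isLazyEval.simB_iff_ctxLE Eval.howeAdequate
  exact ⟨hE, fun n M N => forall_congr' fun σ => hE _ _,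
    fun M N => EvalC.isLazyEval.simB_iff_ctxLE EvalC.howeAdequate,
    EvalC.isLazyEval.satLE_iff_satConv EvalC.howeAdequate,
    fun M N => EvalP.isLazyEval.simB_iff_ctxLE EvalP.howeAdequate,
    EvalP.isLazyEval.satLE_iff_satConv EvalP.howeAdequate⟩
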